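/- Let $q$ be a prime power and let $u\ge 1$, $m\ge 2$ be integers. Put $n_a=(q^{um}-1)/(q^u-1)$ and let $n_b$ be an integer with $4\le n_b\le (q^u-1)n_a+1$. Let $H=H^{q^u}_m$ be an $m\times n_a$ parity-check matrix of the $q^u$-ary Hamming $[n_a,n_a-m,3]$-code, i.e. a matrix over $\mathbb{F}_{q^u}$ whose columns are nonzero and represent each one-dimensional subspace of $\mathbb{F}_{q^u}^m$ exactly once. Let $R=R^q_{n_b}=[\,I_{n_b-1}\mid -\mathbf 1^T\,]$ be the parity-check matrix over $\mathbb{F}_q\subseteq\mathbb{F}_{q^u}$ of the repetition code of length $n_b$. Let $C=\{v\in\mathbb{F}_{q^u}^{n_an_b} : (H\otimes R)v=0\}$ be the linear code over $\mathbb{F}_{q^u}$ with parity-check matrix the Kronecker product $H\otimes R$. For a word $v$ and a code $C$ of length $n$ let $d(v,C)$ be the minimum Hamming distance from $v$ to a codeword, and let $\rho=\max_v d(v,C)$ be the covering radius. The code $C$ is *uniformly packed (in the wide sense)* if there are rational numbers $\alpha_0,\dots,\alpha_\rho$ such that $\sum_{k=0}^{\rho}\alpha_k f_k(v)=1$ for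 every word $v$, where $f_k(v)$ is the number of codewords at Hamming distance $k$ from $v$. It is *completely regular* if for every $l\ge 0$ there are numbers $c_l$ and $b_l$ such that every word $v$ with $d(v,C)=l$ has exactly $c_l$ neighbours (words at Hamming distance $1$ from $v$) at distance $l-1$ from $C$ and exactly $b_l$ neighbours at distance $l+1$ from $C$. Then: 1. $C$ is uniformly packed in the wide sense, has length $n_an_b$, dimension $n_an_b-m(n_b-1)$ and minimum distance $3$, and its covering radius is $\rho=n_b-1$. 2. $C$ is not completely regular. -/

import Mathlib

open scoped Kronecker

namespace CodingTheory

section Codes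

/-- The linear code with parity check matrix `H`: all words `v` over `K` with `H v = 0`. -/
def parityCheckCode {K r ι : Type*} [Field K] [Fintype ι] (H : Matrix r ι K) :
    Submodule K (ι → K) :=
  LinearMap.ker H.mulVecLin

/-- `C` has minimum distance `d`, the least Hamming distance of two distinct codewords. -/
def HasMinDist {ι K : Type*} [Fintype ι] [DecidableEq K] (C : Set (ι → K)) (d : ℕ) : Prop :=
  IsLeast {t : ℕ | ∃ x ∈ C, ∃ y ∈ C, x ≠ y ∧ hammingDist x y = t} d

/-- The distance `d(v, C)` of a word `v` to a (nonempty) code `C`. -/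
noncomputable def distToCode {ι K : Type*} [Fintype ι] [DecidableEq K]
    (C : Set (ι → K)) (v : ι → K) : ℕ :=
  sInf {t : ℕ | ∃ x ∈ C, hammingDist v x = t}

/-- The covering radius: the maximum of `d(v, C)` over all words `v`. The distances are bounded
by the length of the code, so the supremum is a maximum. -/
noncomputable def coveringRadius {ι K : Type*} [Fintype ι] [DecidableEq K]
    (C : Set (ι → K)) : ℕ :=
  ⨆ v : ι → K, distToCode C v

/-- `C` is uniformly packed in the wide sense: with `ρ` the covering radius and `f_k(v)` the
number of codewords at distance `k` from `v`, there are rationals `α_0, …, α_ρ` such that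
`∑_{k ≤ ρ} α_k f_k(v) = 1` for every word `v`. -/
def UniformlyPacked {ι K : Type*} [Fintype ι] [DecidableEq K] (C : Set (ι → K)) : Prop :=
  ∃ α : ℕ → ℚ, ∀ v : ι → K,
    ∑ k ∈ Finset.range (coveringRadius C + 1),
      α k * (({x : ι → K | x ∈ C ∧ hammingDist v x = k}.ncard : ℕ) : ℚ) = 1

/-- `C` is completely regular: for each `l` there are numbers `c` and `b` such that every word at
distance `l` from `C` has exactly `c` neighbours at distance `l - 1` from `C` and exactly `b`
neighbours at distance `l + 1` from `C`, neighbours being words at Hamming distance `1`.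
(For `l = 0` no word is at distance `l - 1`.) -/
def CompletelyRegular {ι K : Type*} [Fintype ι] [DecidableEq K] (C : Set (ι → K)) : Prop :=
  ∀ l : ℕ, ∃ c b : ℕ, ∀ x : ι → K, distToCode C x = l →
    {y : ι → K | hammingDist x y = 1 ∧ distToCode C y + 1 = l}.ncard = c ∧
    {y : ι → K | hammingDist x y = 1 ∧ distToCode C y = l + 1}.ncard = b

end Codes

/-- `H` is a parity check matrix of a Hamming code: its columns are nonzero, and every nonzero
vector is a scalar multiple of exactly one column. So the columns represent the one-dimensional
subspaces, each exactly once. -/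
def IsHammingParityCheck {K r ι : Type*} [Field K] (H : Matrix r ι K) : Prop :=
  (∀ j, H.col j ≠ 0) ∧ ∀ v : r → K, v ≠ 0 → ∃! j, ∃ a : K, v = a • H.col j

/-- The parity check matrix `[I_{n-1} | -1ᵀ]` of the repetition code of length `n`. -/
def repetitionParityCheck (F : Type*) [Field F] (n : ℕ) : Matrix (Fin (n - 1)) (Fin n) F :=
  Matrix.of fun i j =>
    if (j : ℕ) = (i : ℕ) then 1 else if (j : ℕ) = n - 1 then -1 else 0

end CodingTheory

namespace CodingTheory

/-! ### Single-coordinate updates acting on radial functions -/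

section HammingSpace

variable {β A : Type*} [Fintype β] [DecidableEq β] [DecidableEq A]

/-! View a word as an array with `nb` columns and take the `H`-syndrome of each column. Then `C` is
the preimage of the repetition code of length `nb` over the alphabet `K^m`
(`mem_parityCheckCode_kronecker_iff`). Every vector is a multiple of a column of `H`, so one entry
suffices to change one column syndrome at will. Hence distances to `C` are distances of syndrome
words to the constants (`distToCode_le_iff`), namely `nb` minus the largest multiplicity of a
syndrome. There are at least `nb` letters, so the covering radius is `nb - 1`.

Uniform packing rests on the fact that the multiplicities of all letters sum to `nb`, whatever the
word. To write this sum through distances to codewords, start from the indicator of `C` and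
repeatedly sum over single-entry updates. Among words this enlarges the support of a radial function
by one; among syndrome words it lowers the degree of a binomial in the multiplicities by one
(`radialStep_choose`). After `nb - 1` rounds the degree is one (`exists_radial_eq_sum_choose`).

Complete regularity fails at distance `nb - 2`: a word with one coinciding pair of syndromes has a
neighbour with none, a word with two such pairs has no such neighbour. -/

theorem hammingDist_update_add (s x : β → A) (b : β) (c : A) :
    hammingDist (Function.update s b c) x + (if s b ≠ x b then 1 else 0) =
      hammingDist s x + (if c ≠ x b then 1 else 0) := by
  unfold hammingDist
  rw [Finset.card_filter, Finset.card_filter,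
    ← Finset.add_sum_erase _ _ (Finset.mem_univ b),
    ← Finset.add_sum_erase (a := b) _ (fun i => if s i ≠ x i then 1 else 0) (Finset.mem_univ b)]
  have : ∑ i ∈ Finset.univ.erase b, (if Function.update s b c i ≠ x i then 1 else 0) =
      ∑ i ∈ Finset.univ.erase b, (if s i ≠ x i then 1 else 0) := by
    refine Finset.sum_congr rfl fun i hi => ?_
    rw [Function.update_of_ne (Finset.ne_of_mem_erase hi)]
  rw [this, Function.update_self]
  ring

/-- The action on radial functions of summing over all single-coordinate updates, in the
Hamming space of length `n` over an alphabet with `N` letters. -/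
def radialStep (n N : ℕ) (h : ℕ → ℚ) (d : ℕ) : ℚ :=
  d * (h (d - 1) + (N - 1) * h d) + ((n : ℚ) - d) * (h d + (N - 1) * h (d + 1))

theorem sum_update_radial [Fintype A] (h : ℕ → ℚ) (s x : β → A) :
    ∑ b, ∑ c, h (hammingDist (Function.update s b c) x) =
      radialStep (Fintype.card β) (Fintype.card A) h (hammingDist s x) := by
  have inner (b : β) : ∑ c, h (hammingDist (Function.update s b c) x) =
      if s b ≠ x b then h (hammingDist s x - 1) + ((Fintype.card A : ℚ) - 1) * h (hammingDist s x)
      else h (hammingDist s x) + ((Fintype.card A : ℚ) - 1) * h (hammingDist s x + 1) := by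
    have card_erase : ((Finset.univ.erase (x b)).card : ℚ) = Fintype.card A - 1 := by
      rw [Finset.card_erase_of_mem (Finset.mem_univ _), Finset.card_univ,
        Nat.cast_sub (Fintype.card_pos_iff.mpr ⟨x b⟩), Nat.cast_one]
    rw [← Finset.add_sum_erase _ _ (Finset.mem_univ (x b))]
    have hself := hammingDist_update_add s x b (x b)
    have hne (c : A) (hc : c ∈ Finset.univ.erase (x b)) :=
      hammingDist_update_add s x b c
    split_ifs with hb
    · rw [if_pos hb] at hself
      rw [Finset.sum_congr rfl (g := fun _ => h (hammingDist s x)) fun c hc => ?_,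
        Finset.sum_const, nsmul_eq_mul, card_erase]
      · congr 2
        simp at hself
        omega
      · have := hne c hc
        rw [if_pos hb, if_pos (Finset.ne_of_mem_erase hc)] at this
        rw [Nat.add_right_cancel this]
    · rw [if_neg hb] at hself
      rw [Finset.sum_congr rfl (g := fun _ => h (hammingDist s x + 1)) fun c hc => ?_,
        Finset.sum_const, nsmul_eq_mul, card_erase]
      · congr 2
        simpa using hself
      · have := hne c hc
        rw [if_neg hb, if_pos (Finset.ne_of_mem_erase hc)] at this
        rw [← this, add_zero]
  have hcard : (Finset.univ.filter fun b => ¬ (s b ≠ x b)).card + hammingDist s x =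
      Fintype.card β := by
    rw [add_comm]
    exact Finset.card_filter_add_card_filter_not (s := Finset.univ) (fun b => s b ≠ x b)
  simp_rw [inner]
  rw [Finset.sum_ite, Finset.sum_const, Finset.sum_const, nsmul_eq_mul, nsmul_eq_mul, radialStep,
    ← hcard]
  push_cast
  rw [add_sub_cancel_right]
  rfl

/-- The binomial counts the `(j+1)`-sets `S` of agreeing positions. An update outside `S` preserves
agreement on `S` for all `N` letters; inside `S` exactly one letter gives agreement, and then only
the other `j` positions must already agree. Each agreeing `j`-set arises from `n - j` choices of
`S`. -/
theorem radialStep_choose (n N j d : ℕ) (hd : d ≤ n) :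
    radialStep n N (fun e => ((n - e).choose (j + 1) : ℚ)) d =
      N * ((n : ℚ) - (j + 1)) * ((n - d).choose (j + 1) : ℚ) +
        ((n : ℚ) - j) * ((n - d).choose j : ℚ) := by
  obtain ⟨t, rfl⟩ := Nat.exists_eq_add_of_le hd
  have absorb : ((t.choose (j + 1) : ℕ) : ℚ) * (j + 1) = t.choose j * ((t : ℚ) - j) := by
    rcases le_or_gt j t with hjt | hjt
    · have := Nat.choose_succ_right_eq t j
      rw [← Nat.cast_sub hjt]
      exact_mod_cast this
    · rw [Nat.choose_eq_zero_of_lt hjt, Nat.choose_eq_zero_of_lt (by omega)]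
      simp
  have lower : (t : ℚ) * ((t - 1).choose (j + 1) : ℕ) = ((t : ℚ) - (j + 1)) * t.choose (j + 1) := by
    cases t with
    | zero => simp
    | succ t =>
      have h1 := Nat.choose_succ_succ t j
      have h2 := Nat.add_one_mul_choose_eq t j
      have h1' : ((t + 1).choose (j + 1) : ℚ) = t.choose j + t.choose (j + 1) := by
        exact_mod_cast h1
      have h2' : ((t : ℚ) + 1) * t.choose j = (t + 1).choose (j + 1) * (j + 1) := by
        exact_mod_cast h2
      push_cast
      linear_combination (-(t : ℚ) - 1) * h1' - h2'
  have upper : (d : ℚ) * (((d + t - (d - 1)).choose (j + 1) : ℕ) : ℚ) =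
      d * ((t.choose j : ℕ) + (t.choose (j + 1) : ℕ)) := by
    cases d with
    | zero => simp
    | succ d =>
      rw [show d + 1 + t - (d + 1 - 1) = t + 1 by omega, Nat.choose_succ_succ]
      push_cast
      ring
  have e1 : d + t - d = t := by omega
  have e2 : d + t - (d + 1) = t - 1 := by omega
  simp only [radialStep, e1, e2]
  push_cast
  linear_combination upper + ((N : ℚ) - 1) * lower + absorb

end HammingSpace

/-! ### Columns of a Hamming parity check matrix -/

section HammingMatrix

variable {K r ι : Type*} [Field K]

theorem IsHammingParityCheck.exists_smul {H : Matrix r ι K} (hH : IsHammingParityCheck H)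
    [Nonempty ι] (v : r → K) : ∃ a, ∃ c : K, v = c • H.col a := by
  rcases eq_or_ne v 0 with rfl | hv
  · exact ⟨Classical.arbitrary ι, 0, by simp⟩
  · exact (hH.2 v hv).exists

theorem IsHammingParityCheck.smul_inj {H : Matrix r ι K} (hH : IsHammingParityCheck H)
    {a a' : ι} {c c' : K} (hc : c ≠ 0) (h : c • H.col a = c' • H.col a') : a = a' ∧ c = c' := by
  have ha : a = a' := (hH.2 (c • H.col a) (smul_ne_zero hc (hH.1 a))).unique ⟨c, rfl⟩ ⟨c', h⟩
  subst ha
  exact ⟨rfl, smul_left_injective K (hH.1 a) h⟩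

end HammingMatrix

/-! ### Column syndromes and their updates -/

section Syndrome

variable {K r ι β : Type*} [Field K] [Fintype ι]

/-- The syndrome, with respect to `H`, of each column of the array `v`. -/
def colSyndrome (H : Matrix r ι K) (v : ι × β → K) (b : β) : r → K :=
  ∑ a, v (a, b) • H.col a

theorem colSyndrome_sub (H : Matrix r ι K) (v w : ι × β → K) (b : β) :
    colSyndrome H (v - w) b = colSyndrome H v b - colSyndrome H w b := by
  simp [colSyndrome, sub_smul, Finset.sum_sub_distrib]

theorem colSyndrome_congr (H : Matrix r ι K) {v w : ι × β → K} {b : β}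
    (h : ∀ a, v (a, b) = w (a, b)) : colSyndrome H v b = colSyndrome H w b := by
  simp [colSyndrome, h]

theorem colSyndrome_update [DecidableEq ι] [DecidableEq β] (H : Matrix r ι K) (v : ι × β → K)
    (a : ι) (b : β) (c : K) :
    colSyndrome H (Function.update v (a, b) c) =
      Function.update (colSyndrome H v) b (colSyndrome H v b + (c - v (a, b)) • H.col a) := by
  funext b'
  rcases eq_or_ne b' b with rfl | hb
  · rw [Function.update_self, colSyndrome, colSyndrome, ← sub_eq_iff_eq_add',
      ← Finset.sum_sub_distrib, Finset.sum_eq_single a]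
    · simp [sub_smul]
    · intro a' _ ha
      rw [Function.update_of_ne (by simpa using ha), sub_self]
    · simp
  · rw [Function.update_of_ne hb]
    refine colSyndrome_congr H fun a' => ?_
    rw [Function.update_of_ne (by simp [hb])]

theorem IsHammingParityCheck.exists_colSyndrome_eq [DecidableEq ι] {H : Matrix r ι K}
    (hH : IsHammingParityCheck H) [Nonempty ι] (t : β → r → K) :
    ∃ v : ι × β → K, colSyndrome H v = t := by
  choose a c h using fun b => hH.exists_smul (t b)
  refine ⟨fun p => if p.1 = a p.2 then c p.2 else 0, funext fun b => ?_⟩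
  rw [h b, colSyndrome, Finset.sum_eq_single (a b)]
  · simp
  · intro a' _ ha'
    simp [ha']
  · simp

/-- Summing over all scalar multiples of all columns of a Hamming parity check matrix meets each
nonzero vector once, and the zero vector once for each column. -/
theorem IsHammingParityCheck.sum_smul [Fintype K] [Fintype r] [DecidableEq r]
    [DecidableEq K] {H : Matrix r ι K}
    (hH : IsHammingParityCheck H) (ψ : (r → K) → ℚ) (t : r → K) :
    ∑ a, ∑ c : K, ψ (t + c • H.col a) =
      ∑ w, ψ w + ((Fintype.card ι : ℚ) - 1) * ψ t := by
  classical
  have key : ∑ p ∈ (Finset.univ : Finset ι) ×ˢ Finset.univ.erase (0 : K), ψ (t + p.2 • H.col p.1) =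
      ∑ w ∈ Finset.univ.erase (0 : r → K), ψ (t + w) := by
    refine Finset.sum_bij (fun p _ => p.2 • H.col p.1) ?_ ?_ ?_ ?_
    · intro p hp
      simp only [Finset.mem_product, Finset.mem_univ, Finset.mem_erase, true_and, and_true] at hp ⊢
      exact smul_ne_zero hp (hH.1 _)
    · intro p hp p' hp' h
      simp only [Finset.mem_product, Finset.mem_univ, Finset.mem_erase, true_and, and_true] at hp
      exact Prod.ext_iff.mpr (hH.smul_inj hp h)
    · intro w hw
      have hw0 : w ≠ 0 := Finset.ne_of_mem_erase hw
      obtain ⟨a, c, rfl⟩ := (hH.2 w hw0).exists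
      refine ⟨(a, c), ?_, rfl⟩
      simp only [Finset.mem_product, Finset.mem_univ, Finset.mem_erase, true_and, and_true]
      rintro rfl
      simp at hw0
    · intros; rfl
  rw [Finset.sum_product] at key
  have shift : ∑ w, ψ w = ψ t + ∑ w ∈ Finset.univ.erase (0 : r → K), ψ (t + w) := by
    rw [← Equiv.sum_comp (Equiv.addLeft t), ← Finset.add_sum_erase _ _ (Finset.mem_univ 0)]
    simp
  have split (a : ι) : ∑ c : K, ψ (t + c • H.col a) =
      ψ t + ∑ c ∈ Finset.univ.erase (0 : K), ψ (t + c • H.col a) := by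
    rw [← Finset.add_sum_erase _ _ (Finset.mem_univ 0)]
    simp
  simp_rw [split]
  rw [Finset.sum_add_distrib, key, shift, Finset.sum_const, nsmul_eq_mul, Finset.card_univ]
  ring

/-- The update operator on words descends to the one on syndrome words, up to adding a scalar; this
lets both sides be iterated together. -/
theorem IsHammingParityCheck.sum_update_colSyndrome [Fintype K] [Fintype r] [DecidableEq r]
    [DecidableEq K] [Fintype β] [DecidableEq ι] [DecidableEq β] {H : Matrix r ι K}
    (hH : IsHammingParityCheck H) (g : (β → r → K) → ℚ) (v : ι × β → K) :
    ∑ p, ∑ c, g (colSyndrome H (Function.update v p c)) =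
      ∑ b, ∑ w, g (Function.update (colSyndrome H v) b w) +
        Fintype.card β * ((Fintype.card ι : ℚ) - 1) * g (colSyndrome H v) := by
  rw [Fintype.sum_prod_type_right]
  have (b : β) : ∑ a, ∑ c, g (colSyndrome H (Function.update v (a, b) c)) =
      ∑ w, g (Function.update (colSyndrome H v) b w) +
        ((Fintype.card ι : ℚ) - 1) * g (colSyndrome H v) := by
    have := hH.sum_smul (fun w => g (Function.update (colSyndrome H v) b w)) (colSyndrome H v b)
    rw [Function.update_eq_self] at this
    rw [← this]
    refine Finset.sum_congr rfl fun a _ => ?_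
    symm
    rw [← Equiv.sum_comp (Equiv.subRight (v (a, b)))]
    simp only [colSyndrome_update, Equiv.subRight_apply]
  simp_rw [this]
  rw [Finset.sum_add_distrib, Finset.sum_const, nsmul_eq_mul, Finset.card_univ, mul_assoc]

end Syndrome

theorem hammingDist_const_add_card {β A : Type*} [Fintype β] [DecidableEq A] (s : β → A) (w : A) :
    hammingDist s (fun _ => w) + (Finset.univ.filter fun b => s b = w).card = Fintype.card β := by
  classical
  have := Finset.card_filter_add_card_filter_not (s := Finset.univ) (fun b => s b ≠ w)
  simpa [hammingDist] using this

/-! ### Distances, covering radius and failure of complete regularity -/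

section ConstantSyndrome

variable {K r ι β : Type*} [Field K] [DecidableEq K] [Fintype r] [Fintype ι] [Fintype β]
  {H : Matrix r ι K} {C : Set (ι × β → K)}

theorem hammingDist_colSyndrome_le (H : Matrix r ι K) (v x : ι × β → K) :
    hammingDist (colSyndrome H v) (colSyndrome H x) ≤ hammingDist v x := by
  classical
  unfold hammingDist
  refine (Finset.card_le_card fun b hb => ?_).trans (Finset.card_image_le (f := Prod.snd))
  simp only [Finset.mem_filter, Finset.mem_univ, true_and, Finset.mem_image, Prod.exists,
    exists_eq_right] at hb ⊢
  by_contra! h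
  exact hb (colSyndrome_congr H h)

/-- Each wrong column syndrome is corrected by altering a single entry, since the error is a
multiple of some column of `H`. -/
theorem IsHammingParityCheck.exists_colSyndrome_eq_near (hH : IsHammingParityCheck H) [Nonempty ι]
    (v : ι × β → K) (t : β → r → K) :
    ∃ x, colSyndrome H x = t ∧ hammingDist v x ≤ hammingDist (colSyndrome H v) t := by
  classical
  choose a c h using fun b => hH.exists_smul (colSyndrome H v b - t b)
  let z : ι × β → K := fun p => if p.1 = a p.2 then c p.2 else 0
  have hz (b : β) : colSyndrome H z b = colSyndrome H v b - t b := by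
    rw [h b, colSyndrome, Finset.sum_eq_single (a b)]
    · simp [z]
    · intro a' _ ha'
      simp [z, ha']
    · simp
  refine ⟨v - z, funext fun b => by rw [colSyndrome_sub, hz, sub_sub_cancel], ?_⟩
  unfold hammingDist
  refine (Finset.card_le_card fun p hp => ?_).trans
    (Finset.card_image_le (f := fun b => (a b, b)))
  simp only [Finset.mem_filter, Finset.mem_univ, true_and, Finset.mem_image] at hp ⊢
  have hzp : z p ≠ 0 := fun h0 => hp (by simp [h0])
  have hpa : p.1 = a p.2 := by
    by_contra hne
    exact hzp (if_neg hne)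
  refine ⟨p.2, fun heq => hzp ?_, Prod.ext hpa.symm rfl⟩
  have hc : c p.2 = 0 := by
    have := h p.2
    rw [heq, sub_self] at this
    exact (smul_eq_zero.mp this.symm).resolve_right (hH.1 _)
  simp [z, hc]

theorem distToCode_le_iff (hH : IsHammingParityCheck H) [Nonempty ι]
    (hC : ∀ v, v ∈ C ↔ ∃ w, colSyndrome H v = fun _ => w) (v : ι × β → K) (k : ℕ) :
    distToCode C v ≤ k ↔ ∃ w, hammingDist (colSyndrome H v) (fun _ => w) ≤ k := by
  constructor
  · intro hk
    have hne : {t : ℕ | ∃ x ∈ C, hammingDist v x = t}.Nonempty :=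
      ⟨_, 0, (hC 0).mpr ⟨0, by funext b; simp [colSyndrome]⟩, rfl⟩
    obtain ⟨x, hx, hd⟩ := Nat.sInf_mem hne
    obtain ⟨w, hw⟩ := (hC x).mp hx
    refine ⟨w, ?_⟩
    rw [← hw]
    exact (hammingDist_colSyndrome_le H v x).trans (hd.trans_le hk)
  · rintro ⟨w, hw⟩
    obtain ⟨x, hx, hd⟩ := hH.exists_colSyndrome_eq_near v (fun _ => w)
    have hmem : hammingDist v x ∈ {t : ℕ | ∃ x ∈ C, hammingDist v x = t} :=
      ⟨x, (hC x).mpr ⟨w, hx⟩, rfl⟩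
    exact (Nat.sInf_le hmem).trans (hd.trans hw)

theorem distToCode_add_one_le (hH : IsHammingParityCheck H) [Nonempty ι] [Nonempty β]
    (hC : ∀ v, v ∈ C ↔ ∃ w, colSyndrome H v = fun _ => w) (v : ι × β → K) :
    distToCode C v + 1 ≤ Fintype.card β := by
  classical
  let b : β := Classical.arbitrary β
  have h := hammingDist_const_add_card (colSyndrome H v) (colSyndrome H v b)
  have hpos : 0 < (Finset.univ.filter fun b' => colSyndrome H v b' = colSyndrome H v b).card :=
    Finset.card_pos.mpr ⟨b, by simp⟩
  have := (distToCode_le_iff hH hC v _).mpr ⟨colSyndrome H v b, le_rfl⟩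
  omega

/-- A word is at the largest possible distance from the code iff its column syndromes are
pairwise distinct. -/
theorem distToCode_add_one_eq_iff (hH : IsHammingParityCheck H) [Nonempty ι] [Nonempty β]
    (hC : ∀ v, v ∈ C ↔ ∃ w, colSyndrome H v = fun _ => w) (v : ι × β → K) :
    distToCode C v + 1 = Fintype.card β ↔ Function.Injective (colSyndrome H v) := by
  classical
  constructor
  · intro hd b b' hbb
    by_contra hne
    have h := hammingDist_const_add_card (colSyndrome H v) (colSyndrome H v b')
    have hpos : 1 < (Finset.univ.filter fun x => colSyndrome H v x = colSyndrome H v b').card :=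
      Finset.one_lt_card.mpr ⟨b, by simp [hbb], b', by simp, hne⟩
    have := (distToCode_le_iff hH hC v _).mpr ⟨colSyndrome H v b', le_rfl⟩
    omega
  · intro hinj
    obtain ⟨w, hw⟩ := (distToCode_le_iff hH hC v _).mp le_rfl
    have h := hammingDist_const_add_card (colSyndrome H v) w
    have hle : (Finset.univ.filter fun x => colSyndrome H v x = w).card ≤ 1 := by
      rw [Finset.card_le_one]
      intro b hb b' hb'
      simp only [Finset.mem_filter, Finset.mem_univ, true_and] at hb hb'
      exact hinj (hb.trans hb'.symm)
    have := distToCode_add_one_le hH hC v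
    omega

theorem distToCode_add_two_eq (hH : IsHammingParityCheck H) [Nonempty ι] [Nonempty β]
    (hC : ∀ v, v ∈ C ↔ ∃ w, colSyndrome H v = fun _ => w) (v : ι × β → K)
    (hninj : ¬ Function.Injective (colSyndrome H v))
    (hmult : ∀ w : r → K, (Finset.univ.filter fun b => colSyndrome H v b = w).card ≤ 2) :
    distToCode C v + 2 = Fintype.card β := by
  obtain ⟨w, hw⟩ := (distToCode_le_iff hH hC v _).mp le_rfl
  have h := hammingDist_const_add_card (colSyndrome H v) w
  have := hmult w
  have h1 := distToCode_add_one_le hH hC v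
  have h2 := mt (distToCode_add_one_eq_iff hH hC v).mp hninj
  omega

variable [Fintype K]

theorem coveringRadius_add_one (hH : IsHammingParityCheck H) [Nonempty ι] [Nonempty β]
    (hC : ∀ v, v ∈ C ↔ ∃ w, colSyndrome H v = fun _ => w)
    (hcard : Nonempty (β ↪ (r → K))) : coveringRadius C + 1 = Fintype.card β := by
  classical
  obtain ⟨e⟩ := hcard
  obtain ⟨v, hv⟩ := hH.exists_colSyndrome_eq (e : β → r → K)
  have hd : distToCode C v + 1 = Fintype.card β :=
    (distToCode_add_one_eq_iff hH hC v).mpr (hv ▸ e.injective)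
  refine le_antisymm ?_ ?_
  · have : coveringRadius C ≤ Fintype.card β - 1 :=
      ciSup_le fun v => by have := distToCode_add_one_le hH hC v; omega
    have := Fintype.card_pos (α := β)
    omega
  · rw [← hd]
    exact Nat.add_le_add_right
      (le_ciSup (f := fun v => distToCode C v) (Set.finite_range _).bddAbove v) 1

theorem not_completelyRegular (hH : IsHammingParityCheck H) [Nonempty ι]
    (hC : ∀ v, v ∈ C ↔ ∃ w, colSyndrome H v = fun _ => w)
    (hcard : Nonempty (β ↪ (r → K))) (hβ : 4 ≤ Fintype.card β) : ¬ CompletelyRegular C := by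
  classical
  obtain ⟨e⟩ := hcard
  obtain ⟨f⟩ : Nonempty (Fin 4 ↪ β) := Function.Embedding.nonempty_of_card_le (by simpa using hβ)
  have : Nonempty β := ⟨f 0⟩
  have hf {i j : Fin 4} (h : i ≠ j) : f i ≠ f j := f.injective.ne h
  obtain ⟨y, hy⟩ := hH.exists_colSyndrome_eq (e : β → r → K)
  -- One coinciding pair of column syndromes, as a neighbour of a word with none.
  obtain ⟨x₁, hx₁, hyx₁⟩ := hH.exists_colSyndrome_eq_near y
    (Function.update (e : β → r → K) (f 0) (e (f 1)))
  have hx₁f (b : β) : colSyndrome H x₁ b = e (if b = f 0 then f 1 else b) := by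
    rw [hx₁, Function.update_apply]
    split_ifs <;> rfl
  -- Two coinciding pairs of column syndromes.
  obtain ⟨x₂, hx₂⟩ := hH.exists_colSyndrome_eq
    (fun b => e (if b = f 0 then f 1 else if b = f 2 then f 3 else b))
  have hx₂f (b : β) := congrFun hx₂ b
  have hd₁ : distToCode C x₁ + 2 = Fintype.card β := by
    refine distToCode_add_two_eq hH hC x₁ (fun hinj => ?_) fun w => ?_
    · refine hf (by decide : (0 : Fin 4) ≠ 1) (hinj ?_)
      simp [hx₁f]
    · by_contra! hlt
      obtain ⟨a, b, c, ha, hb, hc, hab, hac, hbc⟩ := Finset.two_lt_card_iff.mp hlt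
      simp only [Finset.mem_filter, Finset.mem_univ, true_and, hx₁f] at ha hb hc
      have h1 := e.injective (ha.trans hb.symm)
      have h2 := e.injective (ha.trans hc.symm)
      grind
  have hd₂ : distToCode C x₂ + 2 = Fintype.card β := by
    refine distToCode_add_two_eq hH hC x₂ (fun hinj => ?_) fun w => ?_
    · refine hf (by decide : (0 : Fin 4) ≠ 1) (hinj ?_)
      rw [hx₂f, hx₂f, if_pos rfl, if_neg (hf (by decide)), if_neg (hf (by decide))]
    · by_contra! hlt
      obtain ⟨a, b, c, ha, hb, hc, hab, hac, hbc⟩ := Finset.two_lt_card_iff.mp hlt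
      simp only [Finset.mem_filter, Finset.mem_univ, true_and, hx₂f] at ha hb hc
      have h1 := e.injective (ha.trans hb.symm)
      have h2 := e.injective (ha.trans hc.symm)
      have h13 := hf (by decide : (1 : Fin 4) ≠ 3)
      grind
  intro hreg
  obtain ⟨c, k, hck⟩ := hreg (Fintype.card β - 2)
  have hk₁ := (hck x₁ (by omega)).2
  have hk₂ := (hck x₂ (by omega)).2
  have hk : k ≠ 0 := by
    rw [← hk₁]
    refine Set.ncard_ne_zero_of_mem (a := y) ⟨?_, ?_⟩ (Set.toFinite _)
    · have hle : hammingDist (colSyndrome H y)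
          (Function.update (e : β → r → K) (f 0) (e (f 1))) ≤ 1 := by
        rw [hy]
        unfold hammingDist
        refine (Finset.card_le_card fun b hb => ?_).trans (Finset.card_singleton (f 0)).le
        simp only [Finset.mem_filter, Finset.mem_univ, true_and] at hb
        rw [Finset.mem_singleton]
        by_contra hne
        exact hb (Function.update_of_ne hne _ _).symm
      have hne : x₁ ≠ y := by
        rintro rfl
        have := hx₁f (f 0)
        rw [hy, if_pos rfl] at this
        exact hf (by decide) (e.injective this)
      have := hammingDist_pos.mpr hne
      rw [hammingDist_comm] at this ⊢
      omega
    · have := (distToCode_add_one_eq_iff hH hC y).mpr (hy ▸ e.injective)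
      omega
  refine hk (hk₂.symm.trans ?_)
  rw [Set.ncard_eq_zero (Set.toFinite _), Set.eq_empty_iff_forall_notMem]
  rintro z ⟨hz1, hzd⟩
  have hinj := (distToCode_add_one_eq_iff hH hC z).mp (by omega)
  have hs := (hammingDist_colSyndrome_le H x₂ z).trans hz1.le
  -- One changed entry alters at most one column syndrome, so one of the two coinciding pairs of
  -- `x₂` survives in `z`.
  have hagree (b b' : β) (hbb : b ≠ b') : colSyndrome H x₂ b = colSyndrome H z b ∨
      colSyndrome H x₂ b' = colSyndrome H z b' := by
    by_contra! h
    exact hbb (Finset.card_le_one.mp hs b (by simpa using h.1) b' (by simpa using h.2))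
  have e01 : colSyndrome H x₂ (f 0) = colSyndrome H x₂ (f 1) := by
    rw [hx₂f, hx₂f, if_pos rfl, if_neg (hf (by decide)), if_neg (hf (by decide))]
  have e23 : colSyndrome H x₂ (f 2) = colSyndrome H x₂ (f 3) := by
    rw [hx₂f, hx₂f, if_neg (hf (by decide)), if_pos rfl, if_neg (hf (by decide)),
      if_neg (hf (by decide))]
  have n01 := hinj.ne (hf (by decide : (0 : Fin 4) ≠ 1))
  have n23 := hinj.ne (hf (by decide : (2 : Fin 4) ≠ 3))
  have h02 := hagree _ _ (hf (by decide : (0 : Fin 4) ≠ 2))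
  have h03 := hagree _ _ (hf (by decide : (0 : Fin 4) ≠ 3))
  have h12 := hagree _ _ (hf (by decide : (1 : Fin 4) ≠ 2))
  have h13 := hagree _ _ (hf (by decide : (1 : Fin 4) ≠ 3))
  grind

end ConstantSyndrome

/-! ### Uniform packing -/

section UniformlyPacked

variable {K r ι β : Type*} [Field K] [Fintype K] [DecidableEq K] [Fintype r] [DecidableEq r]
  [Fintype ι] [DecidableEq ι] [Fintype β] [DecidableEq β] {H : Matrix r ι K} {C : Set (ι × β → K)}

theorem exists_radial_eq_sum_choose (hH : IsHammingParityCheck H) [Nonempty β]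
    (hC : ∀ v, v ∈ C ↔ ∃ w, colSyndrome H v = fun _ => w) [DecidablePred (· ∈ C)] (i : ℕ)
    (hi : i < Fintype.card β) :
    ∃ h : ℕ → ℚ, (∀ d, i < d → h d = 0) ∧ ∀ v,
      ∑ x with x ∈ C, h (hammingDist v x) =
        ∑ w, ((Fintype.card β - hammingDist (colSyndrome H v) (fun _ => w)).choose
          (Fintype.card β - i) : ℚ) := by
  induction i with
  | zero =>
    refine ⟨fun d => if d = 0 then 1 else 0, fun d hd => if_neg hd.ne', fun v => ?_⟩
    -- The top binomial detects agreement in all positions, so the sum over `w` is the indicator of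
    -- `C`.
    have hchoose (w : r → K) :
        ((Fintype.card β - hammingDist (colSyndrome H v) (fun _ => w)).choose
          (Fintype.card β - 0) : ℚ) = if colSyndrome H v = fun _ => w then 1 else 0 := by
      split_ifs with h
      · simp [h]
      · have := hammingDist_pos.mpr h
        rw [Nat.choose_eq_zero_of_lt (by omega), Nat.cast_zero]
    simp_rw [hchoose, hammingDist_eq_zero]
    by_cases hv : v ∈ C
    · obtain ⟨w, hw⟩ := (hC v).mp hv
      rw [Finset.sum_ite_eq, if_pos (by simpa using hv), Finset.sum_eq_single w]
      · rw [if_pos hw]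
      · intro w' _ hne
        refine if_neg fun h => hne ?_
        exact (congrFun (hw.symm.trans h) (Classical.arbitrary β)).symm
      · simp
    · rw [Finset.sum_ite_eq, if_neg (by simpa using hv), Finset.sum_eq_zero]
      intro w _
      exact if_neg fun h => hv ((hC v).mpr ⟨w, h⟩)
  | succ i ih =>
    obtain ⟨h, hsupp, hsum⟩ := ih (by omega)
    obtain ⟨j, hj⟩ : ∃ j, Fintype.card β = i + 1 + j := ⟨_, (Nat.add_sub_of_le hi.le).symm⟩
    have hij : Fintype.card β - i = j + 1 := by omega
    have hij' : Fintype.card β - (i + 1) = j := by omega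
    rw [hij] at hsum
    rw [hij']
    -- `κ` collects both multiples of the old binomial sum: one from `radialStep_choose`, one from
    -- the scalar in `sum_update_colSyndrome`. What remains is `i + 1` times the next binomial sum.
    let κ : ℚ := Fintype.card (r → K) * ((Fintype.card β : ℚ) - (j + 1)) +
      Fintype.card β * ((Fintype.card ι : ℚ) - 1)
    refine ⟨fun d => (radialStep (Fintype.card (ι × β)) (Fintype.card K) h d - κ * h d) / (i + 1),
      fun d hd => ?_, fun v => ?_⟩
    · simp [radialStep, hsupp (d - 1) (by omega), hsupp d (by omega), hsupp (d + 1) (by omega)]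
    · have hword : ∑ x with x ∈ C, radialStep (Fintype.card (ι × β)) (Fintype.card K) h
          (hammingDist v x) =
          ∑ p, ∑ c, ∑ x with x ∈ C, h (hammingDist (Function.update v p c) x) := by
        simp_rw [← sum_update_radial]
        rw [Finset.sum_comm]
        exact Finset.sum_congr rfl fun p _ => Finset.sum_comm
      have hsyn := hH.sum_update_colSyndrome (fun s : β → r → K =>
        ∑ w, ((Fintype.card β - hammingDist s (fun _ => w)).choose (j + 1) : ℚ)) v
      have hradial : ∑ b, ∑ t, ∑ w, ((Fintype.card β - hammingDist
          (Function.update (colSyndrome H v) b t) (fun _ => w)).choose (j + 1) : ℚ) =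
          ∑ w, radialStep (Fintype.card β) (Fintype.card (r → K))
            (fun e => ((Fintype.card β - e).choose (j + 1) : ℚ))
            (hammingDist (colSyndrome H v) (fun _ => w)) := by
        simp_rw [← sum_update_radial (fun e => ((Fintype.card β - e).choose (j + 1) : ℚ))]
        symm
        rw [Finset.sum_comm]
        exact Finset.sum_congr rfl fun b _ => Finset.sum_comm
      rw [hradial] at hsyn
      simp_rw [radialStep_choose _ _ _ _ (hammingDist_le_card_fintype)] at hsyn
      rw [Finset.sum_add_distrib, ← Finset.mul_sum, ← Finset.mul_sum] at hsyn
      simp_rw [hsum] at hword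
      rw [← Finset.sum_div, Finset.sum_sub_distrib, ← Finset.mul_sum, hword, hsyn, hsum]
      have hcast : (Fintype.card β : ℚ) - j = i + 1 := by
        rw [hj]
        push_cast
        ring
      rw [hcast]
      have : (i : ℚ) + 1 ≠ 0 := by positivity
      rw [div_eq_iff this]
      ring

theorem uniformlyPacked_of_colSyndrome (hH : IsHammingParityCheck H) [Nonempty ι] [Nonempty β]
    (hC : ∀ v, v ∈ C ↔ ∃ w, colSyndrome H v = fun _ => w)
    (hcard : Nonempty (β ↪ (r → K))) : UniformlyPacked C := by
  classical
  have hρ := coveringRadius_add_one hH hC hcard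
  obtain ⟨h, hsupp, hsum⟩ := exists_radial_eq_sum_choose hH hC (coveringRadius C) (by omega)
  have hβ : (Fintype.card β : ℚ) ≠ 0 := by exact_mod_cast Fintype.card_ne_zero
  refine ⟨fun k => h k / Fintype.card β, fun v => ?_⟩
  have htotal : ∑ x with x ∈ C, h (hammingDist v x) = Fintype.card β := by
    rw [hsum]
    have (w : r → K) : Fintype.card β - hammingDist (colSyndrome H v) (fun _ => w) =
        (Finset.univ.filter fun b => colSyndrome H v b = w).card := by
      have := hammingDist_const_add_card (colSyndrome H v) w
      omega
    simp_rw [this, show Fintype.card β - coveringRadius C = 1 by omega, Nat.choose_one_right]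
    rw [← Nat.cast_sum, ← Finset.card_eq_sum_card_fiberwise (by simp), Finset.card_univ]
  -- Grouping by distance may stop at the covering radius because `h` vanishes beyond it.
  have hfiber : ∑ x with x ∈ C, h (hammingDist v x) =
      ∑ k ∈ Finset.range (coveringRadius C + 1),
        h k * (({x : ι × β → K | x ∈ C ∧ hammingDist v x = k}.ncard : ℕ) : ℚ) := by
    have hcoe (k : ℕ) : {x : ι × β → K | x ∈ C ∧ hammingDist v x = k}.ncard =
        ((Finset.univ.filter (· ∈ C)).filter fun x => hammingDist v x = k).card := by
      rw [← Set.ncard_coe_finset]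
      congr 1
      ext x
      simp
    simp_rw [hcoe, Finset.card_filter _ (Finset.univ.filter (· ∈ C)), Nat.cast_sum, Finset.mul_sum]
    rw [Finset.sum_comm]
    refine Finset.sum_congr rfl fun x _ => ?_
    simp only [Nat.cast_ite, Nat.cast_one, Nat.cast_zero, mul_ite, mul_one, mul_zero]
    rw [Finset.sum_ite_eq]
    split_ifs with hmem
    · rfl
    · exact hsupp _ (by simpa using hmem)
  rw [htotal] at hfiber
  simp_rw [div_mul_eq_mul_div]
  rw [← Finset.sum_div, ← hfiber, div_self hβ]

end UniformlyPacked

/-! ### Minimum distance -/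

section MinDist

variable {K r ι β : Type*} [Field K] [DecidableEq K] [Fintype ι] [Fintype β]
  {H : Matrix r ι K} {C : Set (ι × β → K)}

theorem three_le_card_support_of_sum_smul_eq_zero (hH : IsHammingParityCheck H) {z : ι → K}
    (hz : z ≠ 0) (hsum : ∑ a, z a • H.col a = 0) :
    3 ≤ (Finset.univ.filter fun a => z a ≠ 0).card := by
  classical
  rw [← Finset.sum_filter_of_ne (p := fun a => z a ≠ 0)
    (fun a _ h h0 => h (by rw [h0, zero_smul]))] at hsum
  by_contra! hlt
  obtain ⟨a, ha⟩ := Function.ne_iff.mp hz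
  have hmem : a ∈ Finset.univ.filter fun a => z a ≠ 0 := by simpa using ha
  have hpos := Finset.card_pos.mpr ⟨a, hmem⟩
  obtain h1 | h2 : (Finset.univ.filter fun a => z a ≠ 0).card = 1 ∨
      (Finset.univ.filter fun a => z a ≠ 0).card = 2 := by omega
  · obtain ⟨b, hb⟩ := Finset.card_eq_one.mp h1
    have hzb : b ∈ Finset.univ.filter fun a => z a ≠ 0 := by simp [hb]
    rw [hb, Finset.sum_singleton] at hsum
    exact smul_ne_zero (Finset.mem_filter.mp hzb).2 (hH.1 b) hsum
  · obtain ⟨b, c, hbc, hs⟩ := Finset.card_eq_two.mp h2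
    have hzb : b ∈ Finset.univ.filter fun a => z a ≠ 0 := by simp [hs]
    rw [hs, Finset.sum_pair hbc, add_eq_zero_iff_eq_neg, ← neg_smul] at hsum
    exact hbc (hH.smul_inj (Finset.mem_filter.mp hzb).2 hsum).1

/-- A difference with fewer than three nonzero entries misses a column, so the common syndrome is
zero and every column lies in the Hamming code. -/
theorem three_le_hammingDist (hH : IsHammingParityCheck H)
    (hC : ∀ v, v ∈ C ↔ ∃ w, colSyndrome H v = fun _ => w) (hβ : 3 ≤ Fintype.card β)
    {x y : ι × β → K} (hx : x ∈ C) (hy : y ∈ C) (hxy : x ≠ y) : 3 ≤ hammingDist x y := by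
  classical
  by_contra! hlt
  have hdiff : hammingDist x y = (Finset.univ.filter fun p => (x - y) p ≠ 0).card := by
    simp [hammingDist, sub_ne_zero]
  rw [hdiff] at hlt
  obtain ⟨w₁, hw₁⟩ := (hC x).mp hx
  obtain ⟨w₂, hw₂⟩ := (hC y).mp hy
  have hconst (b : β) : colSyndrome H (x - y) b = w₁ - w₂ := by
    rw [colSyndrome_sub, hw₁, hw₂]
  obtain ⟨b₀, hb₀⟩ : ∃ b, ∀ a, (x - y) (a, b) = 0 := by
    by_contra! h
    choose f hf using h
    have : Fintype.card β ≤ (Finset.univ.filter fun p => (x - y) p ≠ 0).card :=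
      Finset.card_le_card_of_injOn (fun b => (f b, b))
        (fun b _ => by
          rw [Finset.mem_coe, Finset.mem_filter]
          exact ⟨Finset.mem_univ _, hf b⟩)
        (fun b _ b' _ h => (Prod.ext_iff.mp h).2)
    omega
  have hw : w₁ - w₂ = 0 := by
    rw [← hconst b₀, colSyndrome]
    simp [hb₀]
  obtain ⟨⟨a, b⟩, hab⟩ := Function.ne_iff.mp (sub_ne_zero.mpr hxy)
  have hcol := three_le_card_support_of_sum_smul_eq_zero hH (z := fun a => (x - y) (a, b))
    (Function.ne_iff.mpr ⟨a, hab⟩) ((hconst b).trans hw)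
  have : (Finset.univ.filter fun a => (x - y) (a, b) ≠ 0).card ≤
      (Finset.univ.filter fun p => (x - y) p ≠ 0).card :=
    Finset.card_le_card_of_injOn (fun a => (a, b))
      (fun a ha => by simpa using ha)
      (fun a _ a' _ h => (Prod.ext_iff.mp h).1)
  omega

theorem hasMinDist_three [Fintype r] (hH : IsHammingParityCheck H)
    (hC : ∀ v, v ∈ C ↔ ∃ w, colSyndrome H v = fun _ => w) (hβ : 3 ≤ Fintype.card β)
    (hι : 1 < Fintype.card ι) : HasMinDist C 3 := by
  classical
  refine ⟨?_, ?_⟩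
  · obtain ⟨a₀, a₁, h01⟩ := Fintype.one_lt_card_iff.mp hι
    have : Nonempty ι := ⟨a₀⟩
    obtain ⟨b⟩ : Nonempty β := Fintype.card_pos_iff.mp (by omega)
    let v₁ : ι × β → K := Function.update 0 (a₀, b) 1
    let v : ι × β → K := Function.update v₁ (a₁, b) 1
    have hzero : colSyndrome H (0 : ι × β → K) = 0 := by
      funext b
      simp [colSyndrome]
    have h0 : (0 : ι × β → K) ∈ C := (hC 0).mpr ⟨0, hzero⟩
    have hv₁ : v₁ (a₁, b) = 0 := Function.update_of_ne (by simpa using h01.symm) _ _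
    have hdist : hammingDist v 0 = 2 := by
      have h1 := hammingDist_update_add (0 : ι × β → K) 0 (a₀, b) 1
      have h2 := hammingDist_update_add v₁ 0 (a₁, b) 1
      rw [hv₁] at h2
      simp only [Pi.zero_apply, ne_eq, not_true_eq_false, if_false, one_ne_zero,
        not_false_eq_true, if_true, hammingDist_self] at h1 h2
      change hammingDist v₁ 0 + 0 = 0 + 1 at h1
      change hammingDist v 0 + 0 = hammingDist v₁ 0 + 1 at h2
      omega
    -- The weight-two word `v` lives in one column, so one further change reaches a codeword,
    -- nonzero because `v` is at distance 2 from zero.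
    have hsyn : hammingDist (colSyndrome H v) 0 ≤ 1 := by
      have h1 := hammingDist_update_add (0 : β → r → K) 0 b
        (colSyndrome H v₁ b + (1 - v₁ (a₁, b)) • H.col a₁)
      have hv : colSyndrome H v = Function.update (0 : β → r → K) b
          (colSyndrome H v₁ b + (1 - v₁ (a₁, b)) • H.col a₁) := by
        rw [colSyndrome_update]
        nth_rewrite 1 [colSyndrome_update]
        rw [hzero, Function.update_idem]
      rw [← hv, hammingDist_self] at h1
      split_ifs at h1 <;> omega
    obtain ⟨x, hx, hvx⟩ := hH.exists_colSyndrome_eq_near v 0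
    have hxC : x ∈ C := (hC x).mpr ⟨0, hx⟩
    have hx0 : x ≠ 0 := by
      rintro rfl
      omega
    refine ⟨x, hxC, 0, h0, hx0, le_antisymm ?_ (three_le_hammingDist hH hC hβ hxC h0 hx0)⟩
    have := hammingDist_triangle x v 0
    rw [hammingDist_comm x v] at this
    omega
  · rintro t ⟨x, hx, y, hy, hxy, rfl⟩
    exact three_le_hammingDist hH hC hβ hx hy hxy

end MinDist

/-! ### The Kronecker product: membership and dimension -/

section RepetitionProduct

variable {F K r ι : Type*} [Field F] [Field K] [Algebra F K] [Fintype ι] {n : ℕ}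

theorem kronecker_repetitionParityCheck_mulVec (H : Matrix r ι K) (v : ι × Fin (n + 1) → K)
    (i : r) (j : Fin n) :
    ((H ⊗ₖ (repetitionParityCheck F (n + 1)).map (algebraMap F K)).mulVec v) (i, j) =
      colSyndrome H v j.castSucc i - colSyndrome H v (Fin.last n) i := by
  have hrow (k : Fin (n + 1)) : algebraMap F K (repetitionParityCheck F (n + 1) j k) =
      (if k = j.castSucc then 1 else 0) - (if k = Fin.last n then 1 else 0) := by
    have hj := j.isLt
    simp only [repetitionParityCheck, Matrix.of_apply, Fin.ext_iff, Fin.val_castSucc, Fin.val_last,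
      Nat.add_sub_cancel]
    split_ifs <;> first | omega | simp
  simp only [Matrix.mulVec, dotProduct, Fintype.sum_prod_type, Matrix.kroneckerMap_apply,
    Matrix.map_apply, colSyndrome, Finset.sum_apply, Pi.smul_apply, Matrix.col_apply, smul_eq_mul]
  rw [← Finset.sum_sub_distrib]
  refine Finset.sum_congr rfl fun a _ => ?_
  simp_rw [hrow]
  simp only [mul_sub, sub_mul, Finset.sum_sub_distrib, mul_ite, ite_mul, mul_one, mul_zero,
    zero_mul, Finset.sum_ite_eq', Finset.mem_univ, if_true]
  ring

theorem mem_parityCheckCode_kronecker_iff (H : Matrix r ι K) (v : ι × Fin (n + 1) → K) :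
    v ∈ parityCheckCode (H ⊗ₖ (repetitionParityCheck F (n + 1)).map (algebraMap F K)) ↔
      ∃ w, colSyndrome H v = fun _ => w := by
  rw [parityCheckCode, LinearMap.mem_ker, Matrix.mulVecLin_apply]
  constructor
  · intro h
    refine ⟨colSyndrome H v (Fin.last n), funext fun b => ?_⟩
    refine Fin.lastCases rfl (fun j => funext fun i => ?_) b
    have := kronecker_repetitionParityCheck_mulVec (F := F) H v i j
    rw [h] at this
    exact sub_eq_zero.mp this.symm
  · rintro ⟨w, hw⟩
    funext ⟨i, j⟩
    refine (kronecker_repetitionParityCheck_mulVec (F := F) H v i j).trans ?_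
    rw [hw, sub_self, Pi.zero_apply]

theorem finrank_parityCheckCode_kronecker_add [Fintype r] {H : Matrix r ι K}
    (hH : IsHammingParityCheck H) [Nonempty ι] :
    Module.finrank K (parityCheckCode
      (H ⊗ₖ (repetitionParityCheck F (n + 1)).map (algebraMap F K))) + Fintype.card r * n =
      Fintype.card ι * (n + 1) := by
  classical
  have hsurj : Function.Surjective
      (H ⊗ₖ (repetitionParityCheck F (n + 1)).map (algebraMap F K)).mulVecLin := by
    intro t
    -- The product records differences from the last column syndrome, so that one is set to zero.
    obtain ⟨v, hv⟩ := hH.exists_colSyndrome_eq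
      (Fin.snoc (α := fun _ => r → K) (fun j i => t (i, j)) 0)
    refine ⟨v, funext fun ⟨i, j⟩ => ?_⟩
    refine (kronecker_repetitionParityCheck_mulVec (F := F) H v i j).trans ?_
    simp [hv]
  have h := LinearMap.finrank_range_add_finrank_ker
    (H ⊗ₖ (repetitionParityCheck F (n + 1)).map (algebraMap F K)).mulVecLin
  rw [LinearMap.range_eq_top.mpr hsurj, finrank_top, Module.finrank_fintype_fun_eq_card,
    Module.finrank_fintype_fun_eq_card, Fintype.card_prod, Fintype.card_prod, Fintype.card_fin,
    Fintype.card_fin, add_comm] at h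
  exact h

end RepetitionProduct

end CodingTheory

theorem theorem4p3 {F K : Type*} [Field F] [Fintype F] [Field K] [Fintype K] [DecidableEq K]
    [Algebra F K] (q u m na nb : ℕ)
    (hF : Fintype.card F = q) (hK : Fintype.card K = q ^ u)
    (hu : 1 ≤ u) (hm : 2 ≤ m)
    (hna : na = (q ^ (u * m) - 1) / (q ^ u - 1))
    (hnb : 4 ≤ nb) (hnb' : nb ≤ (q ^ u - 1) * na + 1)
    (H : Matrix (Fin m) (Fin na) K) (hH : CodingTheory.IsHammingParityCheck H)
    (C : Submodule K (Fin na × Fin nb → K))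
    (hC : C = CodingTheory.parityCheckCode
      (H ⊗ₖ (CodingTheory.repetitionParityCheck F nb).map (algebraMap F K))) :
    CodingTheory.UniformlyPacked (C : Set (Fin na × Fin nb → K)) ∧
    Fintype.card (Fin na × Fin nb) = na * nb ∧
    (Module.finrank K C : ℤ) = (na : ℤ) * nb - m * ((nb : ℤ) - 1) ∧
    CodingTheory.HasMinDist (C : Set (Fin na × Fin nb → K)) 3 ∧
    CodingTheory.coveringRadius (C : Set (Fin na × Fin nb → K)) = nb - 1 ∧
    ¬ CodingTheory.CompletelyRegular (C : Set (Fin na × Fin nb → K)) := by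
  classical
  -- This turns the upper bound on `nb` into `nb ≤ |K^m|`, which provides a word with distinct
  -- column syndromes.
  have hpow : (q ^ u - 1) * na + 1 = q ^ (u * m) := by
    have hdvd : q ^ u - 1 ∣ q ^ (u * m) - 1 := by
      rw [pow_mul]
      simpa using Nat.sub_dvd_pow_sub_pow (q ^ u) 1 m
    have hq : 0 < q ^ (u * m) := pow_pos (hF ▸ Fintype.card_pos) _
    rw [hna, Nat.mul_div_cancel' hdvd]
    omega
  have hK1 : 1 < q ^ u := hK ▸ Fintype.one_lt_card
  -- If `na ≤ 1`, then `hpow` gives `q^(um) ≤ q^u`, contradicting `m ≥ 2`.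
  have hna1 : 1 < na := by
    by_contra! hle
    have h1 : (q ^ u) ^ 2 ≤ q ^ (u * m) := by
      rw [pow_mul]
      exact Nat.pow_le_pow_right (by omega) hm
    have h2 : (q ^ u - 1) * na ≤ (q ^ u - 1) * 1 := Nat.mul_le_mul_left _ hle
    have h3 : q ^ u * 1 < q ^ u * q ^ u := Nat.mul_lt_mul_of_pos_left hK1 (by omega)
    rw [sq] at h1
    omega
  have : Nonempty (Fin na) := ⟨⟨0, by omega⟩⟩
  obtain ⟨n, rfl⟩ : ∃ n, nb = n + 1 := ⟨nb - 1, by omega⟩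
  have hmem (v : Fin na × Fin (n + 1) → K) : v ∈ (C : Set (Fin na × Fin (n + 1) → K)) ↔
      ∃ w, CodingTheory.colSyndrome H v = fun _ => w := by
    rw [SetLike.mem_coe, hC]
    exact CodingTheory.mem_parityCheckCode_kronecker_iff H v
  have hemb : Nonempty (Fin (n + 1) ↪ (Fin m → K)) := by
    apply Function.Embedding.nonempty_of_card_le
    rw [Fintype.card_fun, Fintype.card_fin, Fintype.card_fin, hK, ← pow_mul, ← hpow]
    exact hnb'
  refine ⟨CodingTheory.uniformlyPacked_of_colSyndrome hH hmem hemb, by simp, ?_,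
    CodingTheory.hasMinDist_three hH hmem (by simp; omega) (by simpa using hna1), ?_,
    CodingTheory.not_completelyRegular hH hmem hemb (by simpa using hnb)⟩
  · have h := CodingTheory.finrank_parityCheckCode_kronecker_add (F := F) (n := n) hH
    rw [← hC, Fintype.card_fin, Fintype.card_fin] at h
    push_cast
    zify at h
    linear_combination h
  · have h := CodingTheory.coveringRadius_add_one hH hmem hemb
    rw [Fintype.card_fin] at h
    omega
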